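/- For a finite connected simple graph $G$ of order $n\ge 2$, let $$\mu(G)=\binom n2^{-1}\sum_{\{u,v\}\subset V(G),\ u\ne v} d_G(u,v)$$ be its average distance, where $d_G(u,v)$ is the distance between $u$ and $v$ in $G$, and let the independence number of $G$ be the maximum cardinality of a set of pairwise non-adjacent vertices of $G$. Let $G$ be a finite connected simple graph of order $n$ and independence number $\alpha$, where $n\ge 2\alpha$ and $\alpha\ge 1$. Then $$ \mu(G) < \begin{cases} \alpha+1 & \text{if } 1\le\alpha\le 6,\\[2pt] \alpha+\dfrac12+\dfrac{4(\alpha-1)}{\alpha^2} & \text{if } \alpha\ge 7.\end{cases} $$ -/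

import Mathlib

namespace SimpleGraph

open Classical in
/-- The sum of the distances `d_G(u, v)` over all unordered pairs `{u, v}` of distinct vertices. -/
noncomputable def wienerIndex {V : Type*} [Fintype V] (G : SimpleGraph V) : ℕ :=
  ∑ e : Sym2 V with ¬ e.IsDiag, Sym2.lift ⟨fun u v => G.dist u v, fun _ _ => G.dist_comm⟩ e

/-- The average distance `μ(G)`: the Wiener index divided by the number of unordered pairs of
distinct vertices. -/
noncomputable def avgDist {V : Type*} [Fintype V] (G : SimpleGraph V) : ℝ :=
  ((Fintype.card V).choose 2 : ℝ)⁻¹ * (G.wienerIndex : ℝ)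

end SimpleGraph

/-! Both bounds exceed `α + 1/2`, and `Connected.avgDist_le` shows `μ(G) ≤ α + 1/2`. Choose a
dominating independent set `I` whose common-neighbour graph `T` is connected
(`Connected.exists_dominating_indepSet`). One step in `T` costs at most two in `G`, so distances in
`G` reduce to distances in `T` between representatives in `I`.

Ordered distance sums over `N` points of a connected graph on `m` vertices are at most `(m - 1) N² /
2`, the extreme case being half the points at each end of a path; a cycle saves a further `N² / 4`.
If `|I| < α`, or if `T` has a cycle, this outweighs the cost of moving each vertex to a neighbour in
`I`.

If `|I| = α` and `T` is a tree, a vertex with two neighbours in `I` is represented by both, and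
averaging over representatives saves because a vertex of a tree is never equidistant from the ends
of an edge. For vertices with one neighbour in `I`, the maximality of `I` gives the saving
(`dist_le_of_unique_neighbor`). -/

namespace SimpleGraph

/-! ### Distance sums of families of points in a connected graph -/

/-- On `W` the distance of `T` is bounded by a kernel `D` whose sum over all pairs of any family of
`|β|` points of `W` is at most `K / 4 * |β| ^ 2`. -/
def DistKernelBound {ι : Type*} (β : Type*) [Fintype β] (T : SimpleGraph ι) (W : Finset ι)
    (K : ℝ) : Prop :=
  ∃ D : ι → ι → ℝ, (∀ x ∈ W, ∀ y ∈ W, (T.dist x y : ℝ) ≤ D x y) ∧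
    ∀ f : β → ι, (∀ b, f b ∈ W) → 4 * ∑ a, ∑ b, D (f a) (f b) ≤ K * (Fintype.card β : ℝ) ^ 2

section DistKernelBound

variable {ι : Type*} {β : Type*} [Fintype β] {T : SimpleGraph ι}

lemma distKernelBound_singleton (x : ι) : DistKernelBound β T {x} 0 := by
  refine ⟨fun _ _ => 0, ?_, ?_⟩ <;> simp

lemma DistKernelBound.mono {W : Finset ι} {K L : ℝ} (h : DistKernelBound β T W K) (hKL : K ≤ L) :
    DistKernelBound β T W L := by
  obtain ⟨D, h1, h2⟩ := h
  exact ⟨D, h1, fun f hf => (h2 f hf).trans (by gcongr)⟩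

lemma Connected.dist_le_dist_add_one (hT : T.Connected) {x y z : ι} (h : T.Adj x y) :
    T.dist z y ≤ T.dist z x + 1 := by
  have := hT.dist_triangle (u := z) (v := x) (w := y)
  rwa [dist_eq_one_iff_adj.mpr h] at this

/-- Retract `y` to `x`. If `E` of the `N` points lie at `y`, only the `2E(N - E) ≤ N²/2` ordered
pairs separated by the retraction lose 1. -/
lemma DistKernelBound.insert_adj [DecidableEq ι] (hT : T.Connected) {W : Finset ι} {K : ℝ}
    (h : DistKernelBound β T W K) {x y : ι} (hx : x ∈ W) (hy : y ∉ W) (hxy : T.Adj x y) :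
    DistKernelBound β T (insert y W) (K + 2) := by
  obtain ⟨D, h1, h2⟩ := h
  set r : ι → ι := Function.update id y x with hr
  have hry : r y = x := by simp [hr]
  have hrW : ∀ z ∈ W, r z = z := fun z hz => by
    rw [hr, Function.update_of_ne (by rintro rfl; exact hy hz)]; rfl
  have hrm : ∀ z ∈ insert y W, r z ∈ W := by
    intro z hz
    rcases Finset.mem_insert.mp hz with rfl | hz
    · rwa [hry]
    · rwa [hrW z hz]
  set e : ι → ℝ := fun z => if z = y then 1 else 0 with he
  have hey : e y = 1 := by simp [he]
  have heW : ∀ z ∈ W, e z = 0 := fun z hz => by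
    simp only [he, ite_eq_right_iff]; rintro rfl; exact absurd hz hy
  refine ⟨fun a b => D (r a) (r b) + (e a + e b - 2 * (e a * e b)), ?_, ?_⟩
  · intro a ha b hb
    have key := h1 _ (hrm a ha) _ (hrm b hb)
    rw [Finset.mem_insert] at ha hb
    rcases ha with rfl | ha <;> rcases hb with rfl | hb
    · simp only [hry, hey, dist_self] at key ⊢
      push_cast at key ⊢; linarith
    · simp only [hry, hey, hrW b hb, heW b hb] at key ⊢
      have := hT.dist_le_dist_add_one (z := b) hxy
      rw [dist_comm, dist_comm (u := b)] at this
      have : (T.dist a b : ℝ) ≤ T.dist x b + 1 := by exact_mod_cast this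
      linarith
    · simp only [hry, hey, hrW a ha, heW a ha] at key ⊢
      have : (T.dist a b : ℝ) ≤ T.dist a x + 1 := by
        exact_mod_cast hT.dist_le_dist_add_one (z := a) hxy
      linarith
    · simp only [hrW a ha, hrW b hb, heW a ha, heW b hb] at key ⊢
      linarith
  · intro f hf
    have key := h2 (fun b => r (f b)) fun b => hrm _ (hf b)
    have hs : ∑ a, ∑ b, (D (r (f a)) (r (f b)) + (e (f a) + e (f b) - 2 * (e (f a) * e (f b)))) =
        ∑ a, ∑ b, D (r (f a)) (r (f b)) + (2 * (Fintype.card β) * (∑ a, e (f a)) -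
          2 * (∑ a, e (f a)) ^ 2) := by
      simp only [Finset.sum_add_distrib, Finset.sum_sub_distrib, ← Finset.mul_sum,
        ← Finset.sum_mul, Finset.sum_const, Finset.card_univ, nsmul_eq_mul]
      ring
    rw [hs]
    nlinarith [sq_nonneg ((Fintype.card β : ℝ) - 2 * ∑ a, e (f a))]

/-- Adding two adjacent vertices, each with a neighbour in `W`, is cheaper than adding two
pendant vertices. -/
lemma DistKernelBound.insert_insert_adj [DecidableEq ι] (hT : T.Connected) {W : Finset ι} {K : ℝ}
    (h : DistKernelBound β T W K) {p q y z : ι} (hp : p ∈ W) (hq : q ∈ W) (hy : y ∉ W)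
    (hz : z ∉ W) (hpy : T.Adj p y) (hqz : T.Adj q z) (hyz : T.Adj y z) :
    DistKernelBound β T (insert y (insert z W)) (K + 3) := by
  obtain ⟨D, h1, h2⟩ := h
  have hne : y ≠ z := hyz.ne
  set r : ι → ι := Function.update (Function.update id z q) y p with hr
  have hry : r y = p := by simp [hr]
  have hrz : r z = q := by simp [hr, Function.update_of_ne hne.symm]
  have hrW : ∀ w ∈ W, r w = w := fun w hw => by
    rw [hr, Function.update_of_ne (by rintro rfl; exact hy hw),
      Function.update_of_ne (by rintro rfl; exact hz hw)]; rfl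
  have hrm : ∀ w ∈ insert y (insert z W), r w ∈ W := by
    intro w hw
    rcases Finset.mem_insert.mp hw with rfl | hw
    · rwa [hry]
    rcases Finset.mem_insert.mp hw with rfl | hw
    · rwa [hrz]
    · rwa [hrW w hw]
  set e : ι → ℝ := fun w => if w = y then 1 else 0 with he
  set g : ι → ℝ := fun w => if w = z then 1 else 0 with hg
  have hey : e y = 1 := by simp [he]
  have hez : e z = 0 := by simp [he, hne.symm]
  have hgz : g z = 1 := by simp [hg]
  have hgy : g y = 0 := by simp [hg, hne]
  have heW : ∀ w ∈ W, e w = 0 := fun w hw => by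
    simp only [he, ite_eq_right_iff]; rintro rfl; exact absurd hw hy
  have hgW : ∀ w ∈ W, g w = 0 := fun w hw => by
    simp only [hg, ite_eq_right_iff]; rintro rfl; exact absurd hw hz
  have adj1 : ∀ {u v : ι} (w : ι), T.Adj u v → (T.dist w v : ℝ) ≤ T.dist w u + 1 :=
    fun w h => by exact_mod_cast hT.dist_le_dist_add_one (z := w) h
  have D0 : ∀ a ∈ W, ∀ b ∈ W, 0 ≤ D a b := fun a ha b hb =>
    (Nat.cast_nonneg _).trans (h1 a ha b hb)
  -- The correction is 1 exactly when `a` and `b` lie in different classes among `{y}`, `{z}`, `W`.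
  -- Three classes separate at most `2N²/3` ordered pairs, and `4 · 2/3 ≤ 3`.
  refine ⟨fun a b => D (r a) (r b) +
    (1 - (e a * e b + g a * g b + (1 - e a - g a) * (1 - e b - g b))), ?_, ?_⟩
  · intro a ha b hb
    have key := h1 _ (hrm a ha) _ (hrm b hb)
    have key0 := D0 _ (hrm a ha) _ (hrm b hb)
    rw [Finset.mem_insert, Finset.mem_insert] at ha hb
    have hyz1 : (T.dist y z : ℝ) = 1 := by exact_mod_cast dist_eq_one_iff_adj.mpr hyz
    rcases ha with rfl | rfl | ha <;> rcases hb with rfl | rfl | hb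
    · simp only [hry, hey, hgy, dist_self] at key0 ⊢
      push_cast; linarith
    · simp only [hry, hrz, hey, hgy, hez, hgz] at key0 ⊢
      linarith
    · simp only [hry, hey, hgy, hrW b hb, heW b hb, hgW b hb] at key ⊢
      have := adj1 b hpy
      rw [dist_comm, dist_comm (u := b)] at this
      linarith
    · rw [dist_comm]
      simp only [hry, hrz, hey, hgy, hez, hgz] at key0 ⊢
      linarith
    · simp only [hrz, hez, hgz, dist_self] at key0 ⊢
      push_cast; linarith
    · simp only [hrz, hez, hgz, hrW b hb, heW b hb, hgW b hb] at key ⊢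
      have := adj1 b hqz
      rw [dist_comm, dist_comm (u := b)] at this
      linarith
    · simp only [hry, hey, hgy, hrW a ha, heW a ha, hgW a ha] at key ⊢
      have := adj1 a hpy
      linarith
    · simp only [hrz, hez, hgz, hrW a ha, heW a ha, hgW a ha] at key ⊢
      have := adj1 a hqz
      linarith
    · simp only [hrW a ha, hrW b hb, heW a ha, heW b hb, hgW a ha, hgW b hb] at key ⊢
      linarith
  · intro f hf
    have key := h2 (fun b => r (f b)) fun b => hrm _ (hf b)
    have hs : ∑ a, ∑ b, (D (r (f a)) (r (f b)) + (1 - (e (f a) * e (f b) + g (f a) * g (f b) +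
          (1 - e (f a) - g (f a)) * (1 - e (f b) - g (f b))))) =
        ∑ a, ∑ b, D (r (f a)) (r (f b)) + ((Fintype.card β : ℝ) ^ 2 - (∑ a, e (f a)) ^ 2 -
          (∑ a, g (f a)) ^ 2 - (Fintype.card β - (∑ a, e (f a)) - (∑ a, g (f a))) ^ 2) := by
      simp only [Finset.sum_add_distrib, Finset.sum_sub_distrib, ← Finset.mul_sum,
        ← Finset.sum_mul, Finset.sum_const, Finset.card_univ, nsmul_eq_mul]
      ring
    rw [hs]
    generalize (∑ a, e (f a)) = E at *
    generalize (∑ a, g (f a)) = G at *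
    generalize (Fintype.card β : ℝ) = n at *
    nlinarith [sq_nonneg (E - G), sq_nonneg (n - E - G - E), sq_nonneg (n - E - G - G),
      sq_nonneg n]

lemma distKernelBound_support [DecidableEq ι] (hT : T.Connected) {x y : ι} (p : T.Walk x y) :
    DistKernelBound β T p.support.toFinset (2 * (p.support.toFinset.card : ℝ) - 2) := by
  induction p with
  | nil => simpa using (distKernelBound_singleton (β := β) (T := T) _)
  | @cons u v w h p ih =>
    rw [Walk.support_cons, List.toFinset_cons]
    by_cases hu : u ∈ p.support.toFinset
    · rwa [Finset.insert_eq_of_mem hu]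
    · have := ih.insert_adj hT (x := v) (by simp) hu h.symm
      rw [Finset.card_insert_of_notMem hu]
      convert this using 1
      push_cast; ring

/-- By connectivity `W` grows one adjacent vertex at a time, each costing 2, so the saving `k`
survives. -/
lemma DistKernelBound.extend_univ [DecidableEq ι] [Fintype ι] (hT : T.Connected) {k : ℝ}
    {W : Finset ι} (hW : W.Nonempty) (h : DistKernelBound β T W (2 * (W.card : ℝ) - k)) :
    DistKernelBound β T Finset.univ (2 * (Fintype.card ι : ℝ) - k) := by
  induction hn : Fintype.card ι - W.card generalizing W with
  | zero =>
    have : W = Finset.univ := by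
      rw [← Finset.card_eq_iff_eq_univ]
      exact le_antisymm (Finset.card_le_univ W) (by omega)
    subst this
    simpa using h
  | succ m ih =>
    obtain ⟨a, ha⟩ := hW
    obtain ⟨b, hb⟩ : ∃ b, b ∉ W := by
      by_contra! hcon
      have : W = Finset.univ := Finset.eq_univ_iff_forall.mpr hcon
      subst this
      simp at hn
    obtain ⟨p⟩ := hT.preconnected a b
    obtain ⟨d, -, hd1, hd2⟩ := p.exists_boundary_dart (W : Set ι) ha hb
    have hd2' : d.snd ∉ W := hd2
    have := h.insert_adj hT hd1 hd2' d.adj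
    refine ih ⟨_, Finset.mem_insert_self d.snd W⟩ ?_ ?_
    · rw [Finset.card_insert_of_notMem hd2']
      convert this using 1
      push_cast; ring
    · rw [Finset.card_insert_of_notMem hd2']; omega

/-- In a connected graph, the distances within any family of `|β|` vertices sum up to at most
`(|ι| - 1) / 2 * |β| ^ 2`. -/
theorem Connected.four_mul_sum_dist_le [Fintype ι] (hT : T.Connected) (f : β → ι) :
    4 * ∑ a, ∑ b, (T.dist (f a) (f b) : ℝ) ≤
      (2 * (Fintype.card ι : ℝ) - 2) * (Fintype.card β : ℝ) ^ 2 := by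
  classical
  obtain ⟨x⟩ := hT.nonempty
  have h := (distKernelBound_singleton (β := β) (T := T) x)
  obtain ⟨D, h1, h2⟩ := DistKernelBound.extend_univ hT (k := 2) ⟨x, Finset.mem_singleton_self x⟩
    (h.mono (by simp))
  refine le_trans ?_ (h2 f fun b => Finset.mem_univ _)
  gcongr
  exact h1 _ (Finset.mem_univ _) _ (Finset.mem_univ _)

/-- The bound of `Connected.four_mul_sum_dist_le` improves by `|β| ^ 2 / 4` in the presence of
a cycle. -/
theorem Connected.four_mul_sum_dist_le_of_not_isAcyclic [Fintype ι] (hT : T.Connected)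
    (hc : ¬ T.IsAcyclic) (f : β → ι) :
    4 * ∑ a, ∑ b, (T.dist (f a) (f b) : ℝ) ≤
      (2 * (Fintype.card ι : ℝ) - 3) * (Fintype.card β : ℝ) ^ 2 := by
  classical
  obtain ⟨W, hW, hb⟩ : ∃ W : Finset ι, W.Nonempty ∧
      DistKernelBound β T W (2 * (W.card : ℝ) - 3) := by
    simp only [IsAcyclic, not_forall, not_not] at hc
    obtain ⟨y, c, hc⟩ := hc
    cases c with
    | nil => exact absurd rfl hc.ne_nil
    | @cons _ z _ hyz q =>
    rw [Walk.cons_isCycle_iff] at hc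
    obtain ⟨hq, hyq⟩ := hc
    cases q with
    | nil => exact absurd hyz (T.loopless.irrefl _)
    | @cons _ p _ hzp q2 =>
    obtain ⟨q3, hq3⟩ : ∃ q3, q3 = q2.reverse := ⟨_, rfl⟩
    rw [Walk.cons_isPath_iff] at hq
    have hpath : q3.IsPath := hq3 ▸ hq.1.reverse
    have hz : z ∉ q3.support := by rw [hq3, Walk.support_reverse, List.mem_reverse]; exact hq.2
    cases q3 with
    | nil =>
      exact absurd (by simp [Sym2.eq_swap]) hyq
    | @cons _ p' _ hyp q4 =>
    rw [Walk.cons_isPath_iff] at hpath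
    rw [Walk.support_cons, List.mem_cons, not_or] at hz
    -- The cycle is `y z p … p' y`: its arc from `p'` to `p` is built vertex by vertex, and `y`, `z`
    -- close it together at cost 3 instead of 4.
    refine ⟨insert y (insert z q4.support.toFinset), ⟨_, Finset.mem_insert_self _ _⟩, ?_⟩
    have := (distKernelBound_support (β := β) hT q4).insert_insert_adj hT (p := p') (q := p)
      (y := y) (z := z) (by simp) (by simp) (by simpa using hpath.2) (by simpa using hz.2)
      hyp.symm hzp.symm hyz
    rw [Finset.card_insert_of_notMem, Finset.card_insert_of_notMem]
    · convert this using 1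
      push_cast; ring
    · simpa using hz.2
    · simpa using ⟨hyz.ne, hpath.2⟩
  obtain ⟨D, h1, h2⟩ := hb.extend_univ hT hW
  refine le_trans ?_ (h2 f fun b => Finset.mem_univ _)
  gcongr
  exact h1 _ (Finset.mem_univ _) _ (Finset.mem_univ _)

end DistKernelBound

/-! ### The Wiener index as a sum over ordered pairs -/

lemma two_mul_wienerIndex {V : Type*} [Fintype V] (G : SimpleGraph V) :
    2 * G.wienerIndex = ∑ u, ∑ v, G.dist u v := by
  classical
  -- An arbitrary order, used only to pick one ordered pair from each unordered one.
  let _ : LinearOrder V := LinearOrder.lift' (Fintype.equivFin V) (Fintype.equivFin V).injective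
  have h1 : G.wienerIndex = ∑ i ∈ (Finset.univ : Finset V).offDiag with i.1 < i.2,
      G.dist i.1 i.2 := by
    have := Finset.sum_sym2_filter_not_isDiag (Finset.univ : Finset V)
      (Sym2.lift ⟨fun u v => G.dist u v, fun _ _ => G.dist_comm⟩)
    simp only [Sym2.lift_mk] at this
    rw [← this, wienerIndex]
    refine Finset.sum_congr ?_ fun _ _ => rfl
    ext e
    simp
  have h2 : ∑ i ∈ (Finset.univ : Finset V).offDiag with i.1 < i.2, G.dist i.1 i.2 =
      ∑ i ∈ (Finset.univ : Finset V).offDiag with ¬ i.1 < i.2, G.dist i.1 i.2 := by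
    refine Finset.sum_bij' (fun i _ => i.swap) (fun i _ => i.swap) ?_ ?_ ?_ ?_ ?_
    · simp only [Finset.mem_filter, Finset.mem_offDiag, Finset.mem_univ, true_and, not_lt]
      exact fun a h => ⟨h.1.symm, h.2.le⟩
    · simp only [Finset.mem_filter, Finset.mem_offDiag, Finset.mem_univ, true_and, not_lt]
      exact fun a h => ⟨h.1.symm, lt_of_le_of_ne h.2 h.1.symm⟩
    · simp
    · simp
    · exact fun a _ => G.dist_comm
  rw [two_mul]
  conv_lhs => enter [2]; rw [h1, h2]
  rw [h1, Finset.sum_filter_add_sum_filter_not, ← Finset.sum_product',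
    ← Finset.diag_union_offDiag, Finset.sum_union (Finset.disjoint_diag_offDiag _),
    Finset.sum_eq_zero (s := Finset.diag _), zero_add]
  rintro ⟨a, b⟩ h
  obtain rfl : a = b := (Finset.mem_diag.mp h).2
  simp

/-! ### Dominating independent sets and their common-neighbour graph -/

variable {V : Type*} {G : SimpleGraph V}

/-- Two distinct vertices are adjacent if they have a common neighbour in `G`. -/
def commonNeighborGraph (G : SimpleGraph V) : SimpleGraph V where
  Adj x y := x ≠ y ∧ ∃ c, G.Adj x c ∧ G.Adj c y
  symm := ⟨fun _ _ ⟨h, c, h1, h2⟩ => ⟨h.symm, c, h2.symm, h1.symm⟩⟩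
  loopless := ⟨fun _ h => h.1 rfl⟩

lemma dist_le_two_mul_dist_induce (hG : G.Connected) {I : Set V}
    (hT : (G.commonNeighborGraph.induce I).Connected) (x y : I) :
    G.dist x y ≤ 2 * (G.commonNeighborGraph.induce I).dist x y := by
  obtain ⟨p, hp⟩ := hT.exists_walk_length_eq_dist x y
  rw [← hp]
  clear hp
  induction p with
  | nil => simp
  | @cons u v w h p ih =>
    have hadj := h
    obtain ⟨-, c, h1, h2⟩ := hadj
    have t1 := hG.dist_triangle (u := u.1) (v := v.1) (w := w.1)
    have t2 := hG.dist_triangle (u := u.1) (v := c) (w := v.1)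
    have e1 := dist_eq_one_iff_adj.mpr h1
    have e2 := dist_eq_one_iff_adj.mpr h2
    simp only [Function.Embedding.subtype_apply] at e1 e2
    rw [Walk.length_cons]
    omega

/-- A connected graph has a dominating independent set whose elements can be reached from one
another by steps of length two. -/
lemma Connected.exists_dominating_indepSet [Fintype V] (hG : G.Connected) :
    ∃ I : Finset V, G.IsIndepSet I ∧ (G.commonNeighborGraph.induce (I : Set V)).Connected ∧
      ∀ v, v ∉ I → ∃ x ∈ I, G.Adj v x := by
  classical
  obtain ⟨x₀⟩ := hG.nonempty
  let P : Finset V → Prop := fun I =>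
    G.IsIndepSet I ∧ (G.commonNeighborGraph.induce (I : Set V)).Connected
  have hne : (Finset.univ.filter P).Nonempty := by
    refine ⟨{x₀}, ?_⟩
    refine Finset.mem_filter.mpr ⟨Finset.mem_univ _, ?_⟩
    simp only [P]
    rw [Finset.coe_singleton]
    refine ⟨Set.pairwise_singleton _ _, ?_⟩
    exact ⟨Preconnected.of_subsingleton⟩
  obtain ⟨I, hI, hmax⟩ := Finset.exists_max_image _ Finset.card hne
  obtain ⟨hI1, hI2⟩ : P I := (Finset.mem_filter.mp hI).2
  refine ⟨I, hI1, hI2, ?_⟩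
  by_contra! hcon
  obtain ⟨v, hv, hvI⟩ := hcon
  obtain ⟨x, hx⟩ : ∃ x, x ∈ I := by
    obtain ⟨⟨x, hx⟩⟩ := hI2.nonempty
    exact ⟨x, hx⟩
  obtain ⟨p⟩ := hG.preconnected x v
  -- A walk leaves the closed neighbourhood of `I` at `d`: `d.snd` is undominated and shares the
  -- neighbour `d.fst` with some `y ∈ I`, so it could be added to the largest set `I`.
  obtain ⟨d, -, hd1, hd2⟩ := p.exists_boundary_dart {w | w ∈ I ∨ ∃ x ∈ I, G.Adj w x} (Or.inl hx)
    (by rintro (h | ⟨y, hy, h⟩); exacts [hv h, hvI y hy h])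
  simp only [Set.mem_ofPred_eq, not_or, not_exists, not_and] at hd1 hd2
  have hadj := d.adj
  rcases hd1 with hd1 | ⟨y, hy, hd1⟩
  · exact hd2.2 _ hd1 hadj.symm
  have hmem : P (insert d.snd I) := by
    refine ⟨?_, ?_⟩
    · rw [Finset.coe_insert]
      exact hI1.insert fun b hb _ => ⟨hd2.2 b hb, fun h => hd2.2 b hb h.symm⟩
    · rw [Finset.coe_insert, Set.insert_eq]
      refine connected_induce_union (v := d.snd) (w := y) ?_ hI2.preconnected rfl hy
        ⟨?_, d.fst, hadj.symm, hd1⟩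
      · exact Preconnected.of_subsingleton
      · rintro rfl; exact hd2.1 hy
  have := hmax _ (Finset.mem_filter.mpr ⟨Finset.mem_univ _, hmem⟩)
  rw [Finset.card_insert_of_notMem hd2.1] at this
  omega

/-- The total distance is controlled by the distances in a dominating set, with a penalty of `1` at
each endpoint outside this set. -/
lemma sum_dist_le_of_dominating [Fintype V] (hG : G.Connected) {I : Finset V}
    (hT : (G.commonNeighborGraph.induce (I : Set V)).Connected)
    (hdom : ∀ v, v ∉ I → ∃ x ∈ I, G.Adj v x) {K : ℝ}
    (hK : ∀ f : V → (I : Set V),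
      4 * ∑ a, ∑ b, ((G.commonNeighborGraph.induce (I : Set V)).dist (f a) (f b) : ℝ) ≤
        2 * K * (Fintype.card V : ℝ) ^ 2) :
    ∑ u, ∑ v, (G.dist u v : ℝ) ≤ K * (Fintype.card V : ℝ) ^ 2 +
      2 * ((Fintype.card V : ℝ) - 1) * (Fintype.card V - I.card) := by
  classical
  set T := G.commonNeighborGraph.induce (I : Set V) with hTdef
  set e : V → ℝ := fun v => if v ∈ I then 0 else 1 with he
  have hf : ∀ v, ∃ x : (I : Set V), (G.dist v x : ℝ) ≤ e v := by
    intro v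
    by_cases hv : v ∈ I
    · exact ⟨⟨v, hv⟩, by simp [he, hv]⟩
    · obtain ⟨x, hx, h⟩ := hdom v hv
      exact ⟨⟨x, hx⟩, by simp [he, hv, dist_eq_one_iff_adj.mpr h]⟩
  choose f hf using hf
  have hE : ∑ v, e v = Fintype.card V - I.card := by
    have : ∀ v, e v = 1 - if v ∈ I then 1 else 0 := fun v => by
      simp only [he]; split_ifs <;> simp
    simp [this]
  -- Cancelling the penalty on the diagonal is what yields the factor `|V| - 1` instead of `|V|`.
  have hpt : ∀ u v, (G.dist u v : ℝ) ≤
      2 * (T.dist (f u) (f v) : ℝ) + (e u + e v - if u = v then 2 * e u else 0) := by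
    intro u v
    split_ifs with h
    · subst h; simp; linarith
    · have t1 := hG.dist_triangle (u := u) (v := f u) (w := v)
      have t2 := hG.dist_triangle (u := (f u : V)) (v := f v) (w := v)
      have t3 := dist_le_two_mul_dist_induce hG hT (f u) (f v)
      rw [← hTdef] at t3
      have t4 := hf v
      rw [dist_comm] at t4
      have : (G.dist u v : ℝ) ≤ G.dist u (f u) + (2 * T.dist (f u) (f v) + G.dist (f v : V) v) := by
        norm_cast; omega
      linarith [hf u]
  calc ∑ u, ∑ v, (G.dist u v : ℝ)
      ≤ ∑ u, ∑ v, (2 * (T.dist (f u) (f v) : ℝ) + (e u + e v - if u = v then 2 * e u else 0)) := by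
        gcongr; exact hpt _ _
    _ = 2 * ∑ u, ∑ v, (T.dist (f u) (f v) : ℝ) + (2 * Fintype.card V - 2) * ∑ v, e v := by
        simp only [Finset.sum_add_distrib, Finset.sum_sub_distrib, ← Finset.mul_sum,
          Finset.sum_const, Finset.card_univ, nsmul_eq_mul, Finset.sum_ite_eq, Finset.mem_univ,
          if_true]
        ring
    _ ≤ _ := by rw [hE]; linarith [hK f]

/-! ### The case of a maximum independent set with a tree -/

/-- In a graph without larger independent sets, two vertices that have a single neighbour in the
independent set `I` are no farther from one another than those neighbours, up to `1`. -/
lemma dist_le_of_unique_neighbor [Fintype V] (hG : G.Connected) {I : Finset V}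
    (hI : G.IsIndepSet I) (hcard : I.card = G.indepNum)
    (hT : (G.commonNeighborGraph.induce (I : Set V)).Connected)
    (htwo : ∀ c, ∀ x ∈ I, ∀ y ∈ I, x ≠ y → G.Adj c x → G.Adj c y → ∀ z ∈ I, G.Adj c z →
      z = x ∨ z = y)
    {u v : V} (x y : (I : Set V)) (hux : G.Adj u x) (hu : ∀ z ∈ I, G.Adj u z → z = x)
    (hvy : G.Adj v y) (hv : ∀ z ∈ I, G.Adj v z → z = y) :
    G.dist u v ≤ 2 * (G.commonNeighborGraph.induce (I : Set V)).dist x y + 1 := by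
  classical
  obtain ⟨p, hp⟩ := hT.exists_walk_length_eq_dist x y
  by_contra! hlt
  set k := (G.commonNeighborGraph.induce (I : Set V)).dist x y with hk
  let X : ℕ → V := fun i => (p.getVert i : V)
  have hX0 : X 0 = x := by simp [X]
  have hXk : X k = y := by simp [X, ← hp]
  have hXI : ∀ i, X i ∈ I := fun i => (p.getVert i).2
  have hc : ∀ i, ∃ c, i < k → X i ≠ X (i + 1) ∧ G.Adj (X i) c ∧ G.Adj c (X (i + 1)) := by
    intro i
    by_cases hi : i < k
    · obtain ⟨hne, c, h1, h2⟩ := p.adj_getVert_succ (hp ▸ hi)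
      exact ⟨c, fun _ => ⟨hne, h1, h2⟩⟩
    · exact ⟨u, fun h => absurd h hi⟩
  choose c hc using hc
  -- The sequence `u, c 0, …, c (k - 1), v` has `k + 2` terms, interlaced with `X 0, …, X k`.
  -- Exchanging the latter for the former in `I` will give a larger independent set.
  let g : ℕ → V := fun i => if i = 0 then u else if i = k + 1 then v else c (i - 1)
  have hg0 : g 0 = u := by simp [g]
  have hgk : g (k + 1) = v := by simp [g]
  have hgm : ∀ i, i < k → g (i + 1) = c i := fun i hi => by simp [g, hi.ne]
  have hgl : ∀ i ≤ k, G.Adj (g i) (X i) := by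
    intro i hi
    rcases i with _ | i
    · rwa [hg0, hX0]
    · rw [hgm i (by omega)]; exact (hc i (by omega)).2.2
  have hgr : ∀ i ≤ k, G.Adj (X i) (g (i + 1)) := by
    intro i hi
    rcases hi.lt_or_eq with hi | hi
    · rw [hgm i hi]; exact (hc i hi).2.1
    · rw [hi, hgk, hXk]; exact hvy.symm
  have hgI : ∀ i ≤ k + 1, ∀ z ∈ I, G.Adj (g i) z → ∃ j ≤ k, z = X j := by
    intro i hi z hz hadj
    rcases i with _ | i
    · exact ⟨0, by omega, by rw [hX0]; exact hu z hz (hg0 ▸ hadj)⟩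
    rcases hi.lt_or_eq with hi | hi
    · rw [hgm i (by omega)] at hadj
      obtain ⟨h1, h2, h3⟩ := hc i (by omega)
      rcases htwo _ _ (hXI i) _ (hXI (i + 1)) h1 h2.symm h3 z hz hadj with h | h
      · exact ⟨i, by omega, h⟩
      · exact ⟨i + 1, by omega, h⟩
    · rw [hi, hgk] at hadj
      exact ⟨k, le_rfl, by rw [hXk]; exact hv z hz hadj⟩
  have hstep : ∀ i ≤ k, G.dist (g i) (g (i + 1)) ≤ 2 := by
    intro i hi
    have := hG.dist_triangle (u := g i) (v := X i) (w := g (i + 1))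
    rw [dist_eq_one_iff_adj.mpr (hgl i hi), dist_eq_one_iff_adj.mpr (hgr i hi)] at this
    exact this
  have hd1 : ∀ i ≤ k + 1, G.dist u (g i) ≤ 2 * i := by
    intro i
    induction i with
    | zero => simp [hg0]
    | succ i ih =>
      intro hi
      have := hG.dist_triangle (u := u) (v := g i) (w := g (i + 1))
      have := ih (by omega)
      have := hstep i (by omega)
      omega
  have hd2 : ∀ j i, i + j = k + 1 → G.dist (g i) v ≤ 2 * j := by
    intro j
    induction j with
    | zero => intro i hi; obtain rfl : i = k + 1 := by omega
              simp [hgk]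
    | succ j ih =>
      intro i hi
      have := hG.dist_triangle (u := g i) (v := g (i + 1)) (w := v)
      have := ih (i + 1) (by omega)
      have := hstep i (by omega)
      omega
  -- Since `d(u, v) ≥ 2(k + 1)` and the `k + 1` steps have length at most 2, no shortcut is
  -- possible.
  have hfar : ∀ i j, i < j → j ≤ k + 1 → 2 ≤ G.dist (g i) (g j) := by
    intro i j hij hj
    have t1 := hG.dist_triangle (u := u) (v := g i) (w := v)
    have t2 := hG.dist_triangle (u := g i) (v := g j) (w := v)
    have t3 := hd1 i (by omega)
    have t4 := hd2 (k + 1 - j) j (by omega)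
    omega
  have hfar' : ∀ i ≤ k + 1, ∀ j ≤ k + 1, i ≠ j → 2 ≤ G.dist (g i) (g j) := by
    intro i hi j hj hij
    rcases hij.lt_or_gt with h | h
    · exact hfar i j h hj
    · rw [dist_comm]; exact hfar j i h hi
  let A : Finset V := (Finset.range (k + 2)).image g
  let B : Finset V := I \ (Finset.range (k + 1)).image X
  have hA : A.card = k + 2 := by
    rw [Finset.card_image_of_injOn, Finset.card_range]
    intro i hi j hj hij
    by_contra hne
    simp only [Finset.coe_range, Set.mem_Iio] at hi hj
    have := hfar' i (by omega) j (by omega) hne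
    rw [hij, dist_self] at this
    omega
  have hB : I.card ≤ B.card + (k + 1) := by
    have h1 := Finset.le_card_sdiff ((Finset.range (k + 1)).image X) I
    have h2 := Finset.card_image_le (s := Finset.range (k + 1)) (f := X)
    rw [Finset.card_range] at h2
    simp only [B]
    omega
  have hAB : ∀ a ∈ A, ∀ b ∈ B, ¬ G.Adj a b := by
    intro a ha b hb hadj
    obtain ⟨i, hi, rfl⟩ := Finset.mem_image.mp ha
    obtain ⟨hbI, hbX⟩ := Finset.mem_sdiff.mp hb
    rw [Finset.mem_range] at hi
    obtain ⟨j, hj, rfl⟩ := hgI i (by omega) b hbI hadj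
    exact hbX (Finset.mem_image_of_mem _ (Finset.mem_range.mpr (by omega)))
  have hgnI : ∀ a ∈ A, a ∉ I := by
    intro a ha haI
    obtain ⟨i, hi, rfl⟩ := Finset.mem_image.mp ha
    rw [Finset.mem_range] at hi
    by_cases h : i ≤ k
    · exact hI haI (hXI i) (hgl i h).ne (hgl i h)
    · obtain rfl : i = k + 1 := by omega
      exact hI (hXI k) haI (hgr k le_rfl).ne (hgr k le_rfl)
  have hdisj : Disjoint A B :=
    Finset.disjoint_left.mpr fun a ha hb => hgnI a ha (Finset.mem_sdiff.mp hb).1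
  have hind : G.IsIndepSet (A ∪ B : Finset V) := by
    intro a ha b hb hab hadj
    rw [Finset.mem_coe, Finset.mem_union] at ha hb
    rcases ha with ha | ha <;> rcases hb with hb | hb
    · obtain ⟨i, hi, rfl⟩ := Finset.mem_image.mp ha
      obtain ⟨j, hj, rfl⟩ := Finset.mem_image.mp hb
      rw [Finset.mem_range] at hi hj
      have := hfar' i (by omega) j (by omega) (by rintro rfl; exact hab rfl)
      rw [dist_eq_one_iff_adj.mpr hadj] at this
      omega
    · exact hAB a ha b hb hadj
    · exact hAB b hb a ha hadj.symm
    · exact hI (Finset.mem_sdiff.mp ha).1 (Finset.mem_sdiff.mp hb).1 hab hadj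
  have := hind.card_le_indepNum
  rw [Finset.card_union_of_disjoint hdisj] at this
  omega

/-- Each vertex `v` is represented by two (possibly equal) elements of `I`: by `v` itself, or by its
neighbours in `I`. -/
lemma exists_representatives {I : Finset V}
    (hdom : ∀ v, v ∉ I → ∃ x ∈ I, G.Adj v x) (v : V) :
    ∃ f : Bool → (I : Set V), (∀ i, G.dist v (f i) ≤ 1) ∧
      ((f false = f true ∧ (v = f true ∨
        G.Adj v (f true) ∧ ∀ z ∈ I, G.Adj v z → z = f true)) ∨
        (G.commonNeighborGraph.induce (I : Set V)).Adj (f false) (f true)) := by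
  by_cases hv : v ∈ I
  · exact ⟨fun _ => ⟨v, hv⟩, by simp⟩
  obtain ⟨x, hx, hvx⟩ := hdom v hv
  by_cases h : ∃ y ∈ I, y ≠ x ∧ G.Adj v y
  · obtain ⟨y, hy, hyx, hvy⟩ := h
    refine ⟨fun i => cond i ⟨x, hx⟩ ⟨y, hy⟩, ?_, Or.inr ⟨hyx, v, hvy.symm, hvx⟩⟩
    rintro (_ | _)
    · exact (dist_eq_one_iff_adj.mpr hvy).le
    · exact (dist_eq_one_iff_adj.mpr hvx).le
  · push Not at h
    refine ⟨fun _ => ⟨x, hx⟩, fun _ => (dist_eq_one_iff_adj.mpr hvx).le,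
      Or.inl ⟨rfl, Or.inr ⟨hvx, fun z hz hvz => ?_⟩⟩⟩
    by_contra hne
    exact h z hz hne hvz

/-- Averaging over the four pairs of representatives bounds `d(u, v)`, for `u ≠ v`, by twice the
mean tree distance plus 1. -/
lemma sum_dist_le_of_isTree [Fintype V] (hG : G.Connected) {I : Finset V}
    (hI : G.IsIndepSet I) (hcard : I.card = G.indepNum)
    (hT : (G.commonNeighborGraph.induce (I : Set V)).IsTree)
    (hdom : ∀ v, v ∉ I → ∃ x ∈ I, G.Adj v x) :
    ∑ u, ∑ v, (G.dist u v : ℝ) ≤ ((I.card : ℝ) - 1) * (Fintype.card V : ℝ) ^ 2 +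
      (Fintype.card V : ℝ) * (Fintype.card V - 1) := by
  classical
  set T := G.commonNeighborGraph.induce (I : Set V) with hTdef
  have htwo : ∀ c, ∀ x ∈ I, ∀ y ∈ I, x ≠ y → G.Adj c x → G.Adj c y → ∀ z ∈ I, G.Adj c z →
      z = x ∨ z = y := by
    intro c x hx y hy hxy hcx hcy z hz hcz
    by_contra! hcon
    have h1 : T.Adj ⟨z, hz⟩ ⟨x, hx⟩ := ⟨hcon.1, c, hcz.symm, hcx⟩
    have h2 : T.Adj ⟨z, hz⟩ ⟨y, hy⟩ := ⟨hcon.2, c, hcz.symm, hcy⟩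
    have h3 : T.Adj ⟨x, hx⟩ ⟨y, hy⟩ := ⟨hxy, c, hcx.symm, hcy⟩
    -- Three neighbours of `c` in `I` would form a triangle in the tree.
    exact hT.dist_ne_of_adj ⟨z, hz⟩ h3
      ((dist_eq_one_iff_adj.mpr h1).trans (dist_eq_one_iff_adj.mpr h2).symm)
  choose f hf1 hf2 using exists_representatives hdom
  have hpt : ∀ u v, u ≠ v → 4 * G.dist u v ≤ 2 * (T.dist (f u false) (f v false) +
      T.dist (f u false) (f v true) + T.dist (f u true) (f v false) +
      T.dist (f u true) (f v true)) + 4 := by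
    intro u v _
    have hub : ∀ i j, G.dist u v ≤ G.dist u (f u i) + 2 * T.dist (f u i) (f v j) +
        G.dist v (f v j) := by
      intro i j
      have t1 := hG.dist_triangle (u := u) (v := f u i) (w := v)
      have t2 := hG.dist_triangle (u := (f u i : V)) (v := f v j) (w := v)
      have t3 := dist_le_two_mul_dist_induce hG hT.connected (f u i) (f v j)
      rw [← hTdef] at t3
      rw [dist_comm (u := v)]
      omega
    have d1 := hub false false
    have d2 := hub false true
    have d3 := hub true false
    have d4 := hub true true
    have a1 := hf1 u false
    have a2 := hf1 u true
    have b1 := hf1 v false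
    have b2 := hf1 v true
    -- Let `t` be the least of the four tree distances, so that `d(u, v) ≤ 2t + 2`. If a
    -- representative pair is an edge, changing its end changes the distance, so the four sum to at
    -- least `4t + 2`, as needed. If both pairs are single vertices, the sharper `2t + 1` is
    -- required.
    rcases hf2 u with ⟨hu, hu'⟩ | hu <;> rcases hf2 v with ⟨hv, hv'⟩ | hv
    · rw [hu, hv] at *
      have key : G.dist u v ≤ 2 * T.dist (f u true) (f v true) + 1 := by
        rcases hu' with hu' | ⟨hu1, hu2⟩
        · have : G.dist u (f u true) = 0 := by rw [← hu', dist_self]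
          omega
        rcases hv' with hv' | ⟨hv1, hv2⟩
        · have : G.dist v (f v true) = 0 := by rw [← hv', dist_self]
          omega
        exact dist_le_of_unique_neighbor hG hI hcard hT.connected htwo _ _ hu1 hu2 hv1 hv2
      omega
    · have n1 := hT.dist_ne_of_adj (f u false) hv
      have n2 := hT.dist_ne_of_adj (f u true) hv
      rw [hu] at *
      omega
    · have n1 := hT.dist_ne_of_adj (f v false) hu
      have n2 := hT.dist_ne_of_adj (f v true) hu
      simp only [dist_comm (u := f v _)] at n1 n2
      rw [hv] at *
      omega
    · have n1 := hT.dist_ne_of_adj (f u false) hv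
      have n2 := hT.dist_ne_of_adj (f u true) hv
      have n3 := hT.dist_ne_of_adj (f v false) hu
      have n4 := hT.dist_ne_of_adj (f v true) hu
      simp only [dist_comm (u := f v _)] at n3 n4
      omega
  have hpt' : ∀ u v, (G.dist u v : ℝ) ≤ 1 / 2 * (T.dist (f u false) (f v false) +
      T.dist (f u false) (f v true) + T.dist (f u true) (f v false) +
      T.dist (f u true) (f v true)) + (1 - if u = v then 1 else 0) := by
    intro u v
    split_ifs with h
    · subst h
      rw [dist_self]
      push_cast
      linarith [show (0 : ℝ) ≤ T.dist (f u false) (f u false) +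
        T.dist (f u false) (f u true) + T.dist (f u true) (f u false) +
        T.dist (f u true) (f u true) by positivity]
    · have : (4 * G.dist u v : ℝ) ≤ 2 * (T.dist (f u false) (f v false) +
        T.dist (f u false) (f v true) + T.dist (f u true) (f v false) +
        T.dist (f u true) (f v true)) + 4 := by exact_mod_cast hpt u v h
      linarith
  -- All `2|V|` representatives are treated as one family.
  have hsum := hT.connected.four_mul_sum_dist_le (fun b : V × Bool => f b.1 b.2)
  simp only [Fintype.sum_prod_type, Fintype.sum_bool, Fintype.card_prod, Fintype.card_bool] at hsum
  have hc : Fintype.card (I : Set V) = I.card := by simp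
  rw [hc] at hsum
  calc ∑ u, ∑ v, (G.dist u v : ℝ)
      ≤ ∑ u, ∑ v, (1 / 2 * ((T.dist (f u false) (f v false) : ℝ) +
      T.dist (f u false) (f v true) + T.dist (f u true) (f v false) +
      T.dist (f u true) (f v true)) + (1 - if u = v then 1 else 0)) := by
        gcongr; exact hpt' _ _
    _ = 1 / 2 * (∑ u, (∑ v, ((T.dist (f u true) (f v true) : ℝ) + T.dist (f u true) (f v false)) +
        ∑ v, ((T.dist (f u false) (f v true) : ℝ) + T.dist (f u false) (f v false)))) +
        (Fintype.card V : ℝ) * (Fintype.card V - 1) := by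
        simp only [Finset.sum_add_distrib, Finset.sum_sub_distrib, ← Finset.mul_sum,
          Finset.sum_const, Finset.card_univ, nsmul_eq_mul, Finset.sum_ite_eq, Finset.mem_univ,
          if_true]
        ring
    _ ≤ _ := by push_cast at hsum; linarith

/-! ### The bound `α + 1/2` -/

/-- If the order is at least twice the independence number `α`, then the average distance is at
most `α + 1 / 2`. -/
theorem Connected.avgDist_le [Fintype V] (hG : G.Connected) (hα : 1 ≤ G.indepNum)
    (hn : 2 * G.indepNum ≤ Fintype.card V) : G.avgDist ≤ G.indepNum + 1 / 2 := by
  classical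
  have hn2 : (2 : ℝ) ≤ Fintype.card V := by exact_mod_cast (by omega : 2 ≤ Fintype.card V)
  have hnα : 2 * (G.indepNum : ℝ) ≤ Fintype.card V := by exact_mod_cast hn
  have hα' : (1 : ℝ) ≤ G.indepNum := by exact_mod_cast hα
  have hsum : ∑ u, ∑ v, (G.dist u v : ℝ) ≤
      (G.indepNum + 1 / 2) * (Fintype.card V * (Fintype.card V - 1)) := by
    obtain ⟨I, hI, hT, hdom⟩ := hG.exists_dominating_indepSet
    have hc : Fintype.card (I : Set V) = I.card := by simp
    have hm := hI.card_le_indepNum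
    have hm0 : (0 : ℝ) ≤ I.card := Nat.cast_nonneg _
    rcases hm.lt_or_eq with hm | hm
    · have hm' : (I.card : ℝ) + 1 ≤ G.indepNum := by exact_mod_cast hm
      refine (sum_dist_le_of_dominating hG hT hdom (K := I.card - 1) fun f => ?_).trans ?_
      · refine (hT.four_mul_sum_dist_le f).trans_eq ?_
        rw [hc]; ring
      · generalize (Fintype.card V : ℝ) = n at *
        have h1 : ((I.card : ℝ) + 3 / 2) * (n * (n - 1)) ≤ (G.indepNum + 1 / 2) * (n * (n - 1)) := by
          have : 0 ≤ n * (n - 1) := mul_nonneg (by linarith) (by linarith)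
          exact mul_le_mul_of_nonneg_right (by linarith) this
        nlinarith [mul_nonneg hm0 (by linarith : 0 ≤ n - 2)]
    · have hmR : (I.card : ℝ) = G.indepNum := by exact_mod_cast hm
      by_cases hac : (G.commonNeighborGraph.induce (I : Set V)).IsAcyclic
      -- With `n = |V|`, the inequality left here amounts to `n ≥ 2α - 1`; this is the case where
      -- the order must be large compared with `α`.
      · refine (sum_dist_le_of_isTree hG hI hm ⟨hT, hac⟩ hdom).trans ?_
        rw [hmR]
        generalize (Fintype.card V : ℝ) = n at *
        nlinarith
      · refine (sum_dist_le_of_dominating hG hT hdom (K := I.card - 3 / 2) fun f => ?_).trans ?_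
        · refine (hT.four_mul_sum_dist_le_of_not_isAcyclic hac f).trans_eq ?_
          rw [hc]; ring
        · rw [hmR]
          generalize (Fintype.card V : ℝ) = n at *
          nlinarith
  have hW : 2 * (G.wienerIndex : ℝ) = ∑ u, ∑ v, (G.dist u v : ℝ) := by
    exact_mod_cast G.two_mul_wienerIndex
  rw [avgDist, Nat.cast_choose_two, inv_mul_le_iff₀ (by nlinarith)]
  linarith

end SimpleGraph

theorem mainTheorem4 {V : Type*} [Fintype V] (G : SimpleGraph V) (hG : G.Connected)
    (n α : ℕ) (hn : Fintype.card V = n) (hα : G.indepNum = α)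
    (hα1 : 1 ≤ α) (hnα : 2 * α ≤ n) :
    (α ≤ 6 → G.avgDist < (α : ℝ) + 1) ∧
      (7 ≤ α → G.avgDist < (α : ℝ) + 1 / 2 + 4 * ((α : ℝ) - 1) / (α : ℝ) ^ 2) := by
  subst hn hα
  have h := hG.avgDist_le hα1 hnα
  refine ⟨fun _ => by linarith, fun h7 => ?_⟩
  have h7' : (7 : ℝ) ≤ G.indepNum := by exact_mod_cast h7
  have : 0 < 4 * ((G.indepNum : ℝ) - 1) / (G.indepNum : ℝ) ^ 2 := by
    apply div_pos <;> nlinarith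
  linarith
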